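/- Let $d\ge 0$ and $N\ge 1$ be integers, let $x_1,\dots,x_N\in\mathcal X$, let $t>0$, and let $f:\mathcal X\times\mathbb R^d\to[\widetilde F_{\min},\widetilde F_{\max}]$ be such that $\theta\mapsto f(x;\theta)$ is $L$-Lipschitz (Euclidean norm, $L\ge 0$) for every $x\in\mathcal X$, and differentiable for every $x=x_i$, $i\in[N]$. Put $\Delta:=\widetilde F_{\max}-\widetilde F_{\min}$ and, for nonempty $S\subseteq[N]$, $$\widetilde R_S(t;\theta):=\frac1t\log\Big(\frac1{|S|}\sum_{i\in S}e^{tf(x_i;\theta)}\Big),\qquad \widetilde R(t;\theta):=\widetilde R_{[N]}(t;\theta).$$ Assume that $\widetilde R(t;\cdot)$ is $\beta$-smooth for some $\beta>0$ (i.e. $\nabla_\theta\widetilde R(t;\cdot)$ is $\beta$-Lipschitz on $\mathbb R^d$; no convexity is assumed), and that the stochastic gradients are uniformly bounded by some $B>0$: $$\Big\|\frac{e^{tf(x_i;\theta)}}{e^{t\widetilde R(t;\theta)}}\nabla_\theta f(x_i;\theta)\Big\|\le B\qquad(\theta\in\mathbb R^d,\ i\in[N]).$$ Let $$k_t:=\Big\lceil\frac{2\Delta\,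 t^2L^2}{\beta e^2}\Big\rceil,\qquad \lambda:=1-\frac1{2e},$$ let $K\ge\max\{k_t,1\}$, and let $$\alpha_k:=\frac1{tLBe^{t\Delta}+1}\ \text{ for } k<k_t,\qquad \alpha_k:=\frac{\sqrt{2\Delta}}{e^{t\Delta}\sqrt{\beta B^2K}}\ \text{ for } k\ge k_t.$$ Consider the stochastic TERM solver with two independent minibatches of size $1$: start from any $\theta_1\in\mathbb R^d$ and $\rho_0:=\widetilde R(t;\theta_1)$; in iteration $k=1,2,\dots$ draw indices $\zeta_k,\xi_k$ uniformly from $[N]$, all draws $(\zeta_k)_k,(\xi_k)_k$ being mutually independent, and set $$\rho_k:=\frac1t\log\Big((1-\lambda)e^{t\rho_{k-1}}+\lambda e^{t\widetilde R_{\{\xi_k\}}(t;\theta_k)}\Big),\qquad \theta_{k+1}:=\theta_k-\alpha_k\,e^{tf(x_{\zeta_k};\theta_k)-t\rho_k}\,\nabla_\theta f(x_{\zeta_k};\theta_k).$$ Then $$\frac1K\sum_{k=k_t}^{K}\mathbb E\big[\|\nabla_\theta\widetilde R(t;\theta_k)\|^2\big]\ \le\ \sqrt8\,B\,e^{t\Delta+1}\sqrt{\frac{\beta\Delta}{K}},$$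 where $\theta_0:=\theta_1$ (this is relevant only if $k_t=0$, i.e. if $\Delta=0$ or $L=0$, when all gradients vanish). -/

import Mathlib

open MeasureTheory ProbabilityTheory
open scoped NNReal ENNReal

noncomputable section

namespace TERM

/-- Parameter space `ℝ^d` with the Euclidean norm. -/
abbrev Param (d : ℕ) : Type := EuclideanSpace ℝ (Fin d)

variable {𝒳 : Type*} {N d : ℕ}

/-- The `t`-tilted loss over the samples indexed by `S ⊆ [N]`,
`(1/t) log ((1/|S|) ∑_{i ∈ S} exp (t f(x_i; θ)))`. -/
def tiltedLossOn (f : 𝒳 → Param d → ℝ) (x : Fin N → 𝒳) (t : ℝ) (S : Finset (Fin N))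
    (θ : Param d) : ℝ :=
  (1 / t) * Real.log ((1 / (S.card : ℝ)) * ∑ i ∈ S, Real.exp (t * f (x i) θ))

/-- The TERM objective `R̃(t; θ)`: the `t`-tilted loss over all `N` samples. -/
def tiltedLoss (f : 𝒳 → Param d → ℝ) (x : Fin N → 𝒳) (t : ℝ) (θ : Param d) : ℝ :=
  tiltedLossOn f x t Finset.univ θ

/-- The tilted stochastic gradient at sample `i`,
`(exp (t f(x_i; θ)) / exp (t R̃(t; θ))) ∇f(x_i; θ)`. -/
def stochGrad (f : 𝒳 → Param d → ℝ) (x : Fin N → 𝒳) (t : ℝ) (i : Fin N)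
    (θ : Param d) : Param d :=
  (Real.exp (t * f (x i) θ) / Real.exp (t * tiltedLoss f x t θ)) • gradient (f (x i)) θ

/-- The update of the running estimate of the tilted objective with the minibatch `B₂`:
`(1/t) log ((1-lam) exp (t R) + lam exp (t R̃_{B₂}))`. -/
def estimateUpdate (f : 𝒳 → Param d → ℝ) (x : Fin N → 𝒳) (t lam : ℝ) (B₂ : Finset (Fin N))
    (θ : Param d) (R : ℝ) : ℝ :=
  (1 / t) * Real.log ((1 - lam) * Real.exp (t * R)
    + lam * Real.exp (t * tiltedLossOn f x t B₂ θ))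

/-- The update of the parameter with the minibatch `B₁`, the step size `α` and the current
estimate `R` of the tilted objective:
`θ - (α/|B₁|) ∑_{i ∈ B₁} exp (t f(x_i; θ) - t R) ∇f(x_i; θ)`. -/
def paramUpdate (f : 𝒳 → Param d → ℝ) (x : Fin N → 𝒳) (t α : ℝ) (B₁ : Finset (Fin N))
    (θ : Param d) (R : ℝ) : Param d :=
  θ - (α / (B₁.card : ℝ)) •
    ∑ i ∈ B₁, Real.exp (t * f (x i) θ - t * R) • gradient (f (x i)) θ

/-- One iteration of the two-minibatch stochastic TERM solver on the pair
(parameter, estimate of the tilted objective): the estimate is refreshed with `B₂` first,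
then the parameter moves along the gradients on `B₁`, weighted with the refreshed estimate. -/
def iteration (f : 𝒳 → Param d → ℝ) (x : Fin N → 𝒳) (t lam α : ℝ) (B₁ B₂ : Finset (Fin N))
    (s : Param d × ℝ) : Param d × ℝ :=
  (paramUpdate f x t α B₁ s.1 (estimateUpdate f x t lam B₂ s.1 s.2),
    estimateUpdate f x t lam B₂ s.1 s.2)

/-- The state after `n` iterations, started at `θ₁` with the exact estimate `R̃(t; θ₁)`.
Iterations are numbered `1, 2, …`; iteration `k` uses the step size `α k` and the
minibatches `B₁ k`, `B₂ k`. -/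
def state (f : 𝒳 → Param d → ℝ) (x : Fin N → 𝒳) (t lam : ℝ) (α : ℕ → ℝ)
    (B₁ B₂ : ℕ → Finset (Fin N)) (θ₁ : Param d) : ℕ → Param d × ℝ
  | 0 => (θ₁, tiltedLoss f x t θ₁)
  | n + 1 => iteration f x t lam (α (n + 1)) (B₁ (n + 1)) (B₂ (n + 1))
      (state f x t lam α B₁ B₂ θ₁ n)

/-- The iterate `θ_k`, `k ≥ 1`: the parameter at the start of iteration `k`, that is, after
`k - 1` iterations (with the convention `θ_0 = θ_1`). -/
def iterate (f : 𝒳 → Param d → ℝ) (x : Fin N → 𝒳) (t lam : ℝ) (α : ℕ → ℝ)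
    (B₁ B₂ : ℕ → Finset (Fin N)) (θ₁ : Param d) (k : ℕ) : Param d :=
  (state f x t lam α B₁ B₂ θ₁ (k - 1)).1

/-- The averaging weight `1 - 1/(2e)`. -/
def averagingWeight : ℝ := 1 - 1 / (2 * Real.exp 1)

/-- The burn-in `k_t = ⌈2 (Fmax - Fmin) t² L² / (β e²)⌉`. -/
def burnIn (t L β Fmin Fmax : ℝ) : ℕ :=
  ⌈2 * (Fmax - Fmin) * t ^ 2 * L ^ 2 / (β * Real.exp 1 ^ 2)⌉₊

/-- The step sizes for the horizon `K`: a fixed one before the burn-in, and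
`√(2 (Fmax - Fmin)) / (exp (t (Fmax - Fmin)) √(β B² K))` from the burn-in on. -/
def stepSize (t L β B Fmin Fmax : ℝ) (K k : ℕ) : ℝ :=
  if k < burnIn t L β Fmin Fmax then
    1 / (t * L * B * Real.exp (t * (Fmax - Fmin)) + 1)
  else
    Real.sqrt (2 * (Fmax - Fmin)) /
      (Real.exp (t * (Fmax - Fmin)) * Real.sqrt (β * B ^ 2 * K))

end TERM

end

/-! Write `R` for the tilted loss, `g` for its gradient, `ρ` for the refreshed estimate, and `z =
exp (tρ - tR)`, `w = 1/z`. The parameter moves by `-αw` times a stochastic gradient that is unbiased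
for `g`, so averaging over the parameter sample gives a first-order decrease `αw‖g‖²`. The
difficulty is that `w` depends on the estimate, and replacing it by its worst case `exp (-tΔ)` would
be wasteful. Instead `w ≥ 1 - z/4`, and `z` is affine in the exponential of the sampled loss: its
conditional mean is exactly `(1 - λ)u + λ`, where `u` is the relative error of the old estimate at
the current parameter.

The unwanted term `u‖g‖²` is charged to the `potential` `R + (α/8) exp (t s.2 - tR) ‖g‖²`. For short
steps the new weight is at most `(e/2)z` and the new squared gradient at most `2‖g‖²` plus a
second-order term. With `1 - λ = 1/(2e)` the coefficient of `u‖g‖²` falls back below `α/8`, and a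
net decrease `(α/2)‖g‖²` remains (`sum_potential_iteration_le`).

Independence turns this into an inequality of expectations, which telescopes
(`sum_integral_norm_gradient_sq_le`). The state entering the averaging window matters only through
bounds valid for every reachable state. The step size balances gain against error
(`sum_le_of_balanced_step`). For horizons too short for the argument, the pointwise bounds `‖g‖ ≤ B`
and `‖g‖² ≤ 2βΔ` already suffice. -/

noncomputable section

namespace TERM

/-! ### Smooth functions: descent inequality and gradient bounds. -/

section Smooth

variable {E : Type*} [NormedAddCommGroup E] [InnerProductSpace ℝ E] [CompleteSpace E]
  {R : E → ℝ} {β : ℝ≥0}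

/-- The quadratic upper bound for a function with Lipschitz gradient. -/
theorem le_quadratic_of_lipschitz_gradient (hd : Differentiable ℝ R)
    (hs : LipschitzWith β (gradient R)) (x v : E) :
    R (x + v) ≤ R x + inner ℝ (gradient R x) v + β / 2 * ‖v‖ ^ 2 := by
  -- Along the segment, the gap to the quadratic bound has nonpositive derivative: Cauchy–Schwarz
  -- and the Lipschitz gradient give `β s ‖v‖²`, which the last term cancels.
  have hder : ∀ s : ℝ, HasDerivAt
      (fun s : ℝ => R (x + s • v) - s * inner ℝ (gradient R x) v - β / 2 * ‖v‖ ^ 2 * s ^ 2)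
      (inner ℝ (gradient R (x + s • v)) v - inner ℝ (gradient R x) v
        - β / 2 * ‖v‖ ^ 2 * (2 * s)) s := by
    intro s
    have h1 : HasDerivAt (fun s : ℝ => x + s • v) v s := by
      simpa using ((hasDerivAt_id s).smul_const v).const_add x
    have h2 := ((hd (x + s • v)).hasGradientAt.hasFDerivAt).comp_hasDerivAt s h1
    have h3 : HasDerivAt (fun s : ℝ => s * inner ℝ (gradient R x) v)
        (inner ℝ (gradient R x) v) s := by
      simpa using (hasDerivAt_id s).mul_const (inner ℝ (gradient R x) v)
    have h4 : HasDerivAt (fun s : ℝ => β / 2 * ‖v‖ ^ 2 * s ^ 2)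
        (β / 2 * ‖v‖ ^ 2 * (2 * s)) s := by
      simpa using (hasDerivAt_pow 2 s).const_mul ((β : ℝ) / 2 * ‖v‖ ^ 2)
    exact (h2.sub h3).sub h4
  have hanti : AntitoneOn
      (fun s : ℝ => R (x + s • v) - s * inner ℝ (gradient R x) v - β / 2 * ‖v‖ ^ 2 * s ^ 2)
      (Set.Icc 0 1) := by
    apply antitoneOn_of_deriv_nonpos (convex_Icc 0 1)
    · exact fun s _ => (hder s).continuousAt.continuousWithinAt
    · exact fun s _ => (hder s).differentiableAt.differentiableWithinAt
    · intro s hs'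
      rw [interior_Icc] at hs'
      rw [(hder s).deriv, ← inner_sub_left]
      have h5 := real_inner_le_norm (gradient R (x + s • v) - gradient R x) v
      have h6 := hs.dist_le_mul (x + s • v) x
      rw [dist_eq_norm, dist_eq_norm, add_sub_cancel_left, norm_smul, Real.norm_eq_abs,
        abs_of_pos hs'.1] at h6
      have h7 := mul_le_mul_of_nonneg_right h6 (norm_nonneg v)
      linarith
  have h := hanti (Set.left_mem_Icc.2 zero_le_one) (Set.right_mem_Icc.2 zero_le_one) zero_le_one
  simp only [one_smul, zero_smul, add_zero] at h
  linarith

/-- A bounded function with Lipschitz gradient has a bounded gradient. -/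
theorem norm_gradient_sq_le_of_mem_Icc (hd : Differentiable ℝ R)
    (hs : LipschitzWith β (gradient R)) (hβ : 0 < β) {m M : ℝ}
    (hb : ∀ x, R x ∈ Set.Icc m M) (x : E) :
    ‖gradient R x‖ ^ 2 ≤ 2 * β * (M - m) := by
  have hβ' : (0 : ℝ) < β := hβ
  -- This displacement minimises the quadratic upper bound; its minimum cannot lie below `m`.
  have h := le_quadratic_of_lipschitz_gradient hd hs x (-(β : ℝ)⁻¹ • gradient R x)
  rw [real_inner_smul_right, real_inner_self_eq_norm_sq, norm_smul, norm_neg, norm_inv,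
    Real.norm_eq_abs, abs_of_pos hβ', mul_pow] at h
  have h1 := (hb (x + -(β : ℝ)⁻¹ • gradient R x)).1
  have h2 := (hb x).2
  have h3 : (β : ℝ) / 2 * ((β : ℝ)⁻¹ ^ 2 * ‖gradient R x‖ ^ 2)
      = (β : ℝ)⁻¹ * ‖gradient R x‖ ^ 2 / 2 := by
    field_simp
  have h4 : (β : ℝ)⁻¹ * ‖gradient R x‖ ^ 2 ≤ 2 * (M - m) := by linarith
  calc ‖gradient R x‖ ^ 2 = β * ((β : ℝ)⁻¹ * ‖gradient R x‖ ^ 2) := by field_simp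
    _ ≤ β * (2 * (M - m)) := by gcongr
    _ = _ := by ring

theorem sub_le_mul_norm_sub_of_norm_gradient_le (hd : Differentiable ℝ R) {C : ℝ}
    (hC : ∀ x, ‖gradient R x‖ ≤ C) (x y : E) : R x - R y ≤ C * ‖x - y‖ := by
  have h := convex_univ.norm_image_sub_le_of_norm_fderiv_le (f := R) (C := C) (𝕜 := ℝ)
    (fun z _ => hd z) (fun z _ => by
      have := hC z
      rwa [gradient, LinearIsometryEquiv.norm_map] at this) (Set.mem_univ y) (Set.mem_univ x)
  exact (le_abs_self _).trans h

theorem norm_gradient_sq_le_of_lipschitz (hs : LipschitzWith β (gradient R)) (x y : E) :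
    ‖gradient R y‖ ^ 2 ≤ 2 * ‖gradient R x‖ ^ 2 + 2 * β ^ 2 * ‖y - x‖ ^ 2 := by
  have h := hs.dist_le_mul y x
  rw [dist_eq_norm, dist_eq_norm] at h
  have h1 : ‖gradient R y‖ ≤ ‖gradient R x‖ + β * ‖y - x‖ := by
    have := norm_le_norm_add_norm_sub' (gradient R y) (gradient R x)
    linarith
  have h2 := pow_le_pow_left₀ (norm_nonneg _) h1 2
  nlinarith [sq_nonneg (‖gradient R x‖ - β * ‖y - x‖)]

end Smooth

/-! ### The tilted loss and the two updates. -/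

section TiltedLoss

variable {𝒳 : Type*} {N d : ℕ} {f : 𝒳 → Param d → ℝ} {x : Fin N → 𝒳} {t Fmin Fmax : ℝ}

theorem exp_mul_tiltedLoss [NeZero N] (ht : 0 < t) (θ : Param d) :
    Real.exp (t * tiltedLoss f x t θ) = (1 / (N : ℝ)) * ∑ i, Real.exp (t * f (x i) θ) := by
  have hN : (0 : ℝ) < N := Nat.cast_pos.2 (NeZero.pos N)
  have hpos : 0 < (1 / (N : ℝ)) * ∑ i, Real.exp (t * f (x i) θ) :=
    mul_pos (by positivity)
      (Finset.sum_pos (fun i _ => Real.exp_pos _) ⟨⟨0, NeZero.pos N⟩, Finset.mem_univ _⟩)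
  rw [tiltedLoss, tiltedLossOn, Finset.card_univ, Fintype.card_fin, ← mul_assoc,
    mul_one_div_cancel ht.ne', one_mul, Real.exp_log hpos]

theorem tiltedLossOn_singleton (ht : 0 < t) (j : Fin N) (θ : Param d) :
    tiltedLossOn f x t {j} θ = f (x j) θ := by
  simp [tiltedLossOn, ht.ne']

theorem tiltedLoss_mem_Icc [NeZero N] (ht : 0 < t)
    (hbdd : ∀ z θ, Fmin ≤ f z θ ∧ f z θ ≤ Fmax) (θ : Param d) :
    tiltedLoss f x t θ ∈ Set.Icc Fmin Fmax := by
  have hN : (0 : ℝ) < N := Nat.cast_pos.2 (NeZero.pos N)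
  have hexp := exp_mul_tiltedLoss (f := f) (x := x) ht θ
  constructor
  · refine le_of_mul_le_mul_left (Real.exp_le_exp.1 ?_) ht
    rw [hexp, one_div, ← div_eq_inv_mul, le_div_iff₀ hN]
    calc Real.exp (t * Fmin) * N = ∑ _i : Fin N, Real.exp (t * Fmin) := by simp [mul_comm]
      _ ≤ _ := Finset.sum_le_sum fun i _ =>
        Real.exp_le_exp.2 (mul_le_mul_of_nonneg_left (hbdd _ _).1 ht.le)
  · refine le_of_mul_le_mul_left (Real.exp_le_exp.1 ?_) ht
    rw [hexp, one_div, ← div_eq_inv_mul, div_le_iff₀ hN]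
    calc _ ≤ ∑ _i : Fin N, Real.exp (t * Fmax) := Finset.sum_le_sum fun i _ =>
        Real.exp_le_exp.2 (mul_le_mul_of_nonneg_left (hbdd _ _).2 ht.le)
      _ = _ := by simp [mul_comm]

/-- The gradient of the tilted loss is the mean of the tilted stochastic gradients. -/
theorem hasGradientAt_tiltedLoss [NeZero N] (ht : 0 < t)
    (hdiff : ∀ i, Differentiable ℝ (f (x i))) (θ : Param d) :
    HasGradientAt (tiltedLoss f x t) ((1 / (N : ℝ)) • ∑ i, stochGrad f x t i θ) θ := by
  have hN : (0 : ℝ) < N := Nat.cast_pos.2 (NeZero.pos N)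
  have hexp := exp_mul_tiltedLoss (f := f) (x := x) ht θ
  have hne : (1 / (N : ℝ)) * ∑ i, Real.exp (t * f (x i) θ) ≠ 0 := by
    rw [← hexp]; exact (Real.exp_pos _).ne'
  have h1 : ∀ i, HasFDerivAt (fun θ => Real.exp (t * f (x i) θ)) _ θ := fun i =>
    ((hdiff i θ).hasGradientAt.hasFDerivAt.const_mul t).exp
  have h2 := (((HasFDerivAt.fun_sum (u := Finset.univ) fun i _ => h1 i).const_mul
    (1 / (N : ℝ))).log hne).const_mul (1 / t)
  rw [hasGradientAt_iff_hasFDerivAt]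
  have h3 : tiltedLoss f x t = fun θ =>
      (1 / t) * Real.log ((1 / (N : ℝ)) * ∑ i, Real.exp (t * f (x i) θ)) := by
    funext θ
    simp [tiltedLoss, tiltedLossOn]
  rw [h3]
  refine h2.congr_fderiv ?_
  rw [← hexp]
  simp only [stochGrad, map_smul, map_sum, Finset.smul_sum, smul_smul]
  refine Finset.sum_congr rfl fun i _ => ?_
  congr 1
  field_simp

theorem gradient_tiltedLoss [NeZero N] (ht : 0 < t)
    (hdiff : ∀ i, Differentiable ℝ (f (x i))) (θ : Param d) :
    gradient (tiltedLoss f x t) θ = (1 / (N : ℝ)) • ∑ i, stochGrad f x t i θ :=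
  (hasGradientAt_tiltedLoss ht hdiff θ).gradient

theorem differentiable_tiltedLoss [NeZero N] (ht : 0 < t)
    (hdiff : ∀ i, Differentiable ℝ (f (x i))) : Differentiable ℝ (tiltedLoss f x t) :=
  fun θ => (hasGradientAt_tiltedLoss ht hdiff θ).differentiableAt

theorem norm_gradient_tiltedLoss_le [NeZero N] (ht : 0 < t)
    (hdiff : ∀ i, Differentiable ℝ (f (x i))) {B : ℝ}
    (hgrad : ∀ i θ, ‖stochGrad f x t i θ‖ ≤ B) (θ : Param d) :
    ‖gradient (tiltedLoss f x t) θ‖ ≤ B := by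
  have hN : (0 : ℝ) < N := Nat.cast_pos.2 (NeZero.pos N)
  rw [gradient_tiltedLoss ht hdiff, norm_smul, Real.norm_of_nonneg (by positivity), one_div,
    ← div_eq_inv_mul, div_le_iff₀ hN]
  calc _ ≤ ∑ i : Fin N, ‖stochGrad f x t i θ‖ := norm_sum_le _ _
    _ ≤ ∑ _i : Fin N, B := Finset.sum_le_sum fun i _ => hgrad i θ
    _ = _ := by simp [mul_comm]

/-- On the exponential scale the update is an affine average, which is why its mean over the sample
can be computed exactly. -/
theorem exp_mul_estimateUpdate (ht : 0 < t) {lam : ℝ} (h0 : 0 ≤ lam) (h1 : lam < 1)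
    (j : Fin N) (θ : Param d) (ρ : ℝ) :
    Real.exp (t * estimateUpdate f x t lam {j} θ ρ)
      = (1 - lam) * Real.exp (t * ρ) + lam * Real.exp (t * f (x j) θ) := by
  have hpos : 0 < (1 - lam) * Real.exp (t * ρ) + lam * Real.exp (t * f (x j) θ) :=
    add_pos_of_pos_of_nonneg (mul_pos (by linarith) (Real.exp_pos _))
      (mul_nonneg h0 (Real.exp_pos _).le)
  rw [estimateUpdate, tiltedLossOn_singleton ht, ← mul_assoc,
    mul_one_div_cancel ht.ne', one_mul, Real.exp_log hpos]

theorem estimateUpdate_mem_Icc (ht : 0 < t) {lam : ℝ} (h0 : 0 ≤ lam) (h1 : lam < 1)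
    (hbdd : ∀ z θ, Fmin ≤ f z θ ∧ f z θ ≤ Fmax) (j : Fin N) (θ : Param d) {ρ : ℝ}
    (hρ : ρ ∈ Set.Icc Fmin Fmax) :
    estimateUpdate f x t lam {j} θ ρ ∈ Set.Icc Fmin Fmax := by
  have hexp := exp_mul_estimateUpdate (f := f) (x := x) ht h0 h1 j θ ρ
  have hmono : ∀ {a b : ℝ}, a ≤ b → Real.exp (t * a) ≤ Real.exp (t * b) := fun h =>
    Real.exp_le_exp.2 (mul_le_mul_of_nonneg_left h ht.le)
  have h1' : 0 ≤ 1 - lam := by linarith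
  constructor
  · refine le_of_mul_le_mul_left (Real.exp_le_exp.1 ?_) ht
    have := mul_le_mul_of_nonneg_left (hmono hρ.1) h1'
    have := mul_le_mul_of_nonneg_left (hmono (hbdd (x j) θ).1) h0
    rw [hexp]; linarith
  · refine le_of_mul_le_mul_left (Real.exp_le_exp.1 ?_) ht
    have := mul_le_mul_of_nonneg_left (hmono hρ.2) h1'
    have := mul_le_mul_of_nonneg_left (hmono (hbdd (x j) θ).2) h0
    rw [hexp]; linarith

/-- Separates the bounded, unbiased stochastic gradient from the scalar error of the estimate. -/
theorem paramUpdate_singleton (α : ℝ) (i : Fin N) (θ : Param d) (ρ : ℝ) :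
    paramUpdate f x t α {i} θ ρ
      = θ - (α * Real.exp (t * tiltedLoss f x t θ - t * ρ)) • stochGrad f x t i θ := by
  simp only [paramUpdate, stochGrad, Finset.card_singleton, Finset.sum_singleton, smul_smul,
    Nat.cast_one, div_one, Real.exp_sub]
  congr 2
  have := (Real.exp_pos (t * tiltedLoss f x t θ)).ne'
  field_simp

end TiltedLoss

/-! ### Decrease of the potential in one iteration. -/

section Potential

variable {𝒳 : Type*} {N d : ℕ} {f : 𝒳 → Param d → ℝ} {x : Fin N → 𝒳}
  {t B Fmin Fmax α : ℝ} {β : ℝ≥0}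

/-- The squared gradient of the tilted loss, weighted with the relative error of the running
estimate `s.2`. -/
def weightedGradSq (f : 𝒳 → Param d → ℝ) (x : Fin N → 𝒳) (t : ℝ) (s : Param d × ℝ) : ℝ :=
  Real.exp (t * s.2 - t * tiltedLoss f x t s.1) * ‖gradient (tiltedLoss f x t) s.1‖ ^ 2

/-- The tilted loss corrected by the weighted squared gradient. It decreases in mean along the
solver, although the loss alone need not do so at a rate comparable with the squared gradient. -/
def potential (f : 𝒳 → Param d → ℝ) (x : Fin N → 𝒳) (t α : ℝ) (s : Param d × ℝ) : ℝ :=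
  tiltedLoss f x t s.1 + α / 8 * weightedGradSq f x t s

/-- The amount by which the mean of the potential may exceed its previous value. -/
def potentialError (t B Δ α β : ℝ) : ℝ :=
  β / 2 * (α * B * Real.exp (t * Δ)) ^ 2
    + α / 8 * (Real.exp 1 / 2 * (2 * β ^ 2 * (α * B) ^ 2 * Real.exp (t * Δ)))

theorem averagingWeight_nonneg : 0 ≤ averagingWeight := by
  have h := Real.add_one_le_exp 1
  rw [averagingWeight, sub_nonneg, div_le_one (by positivity)]
  linarith

theorem averagingWeight_lt_one : averagingWeight < 1 := by
  rw [averagingWeight]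
  have : 0 < 1 / (2 * Real.exp 1) := by positivity
  linarith

theorem weightedGradSq_nonneg (s : Param d × ℝ) : 0 ≤ weightedGradSq f x t s := by
  unfold weightedGradSq; positivity

theorem weightedGradSq_le [NeZero N] (ht : 0 < t)
    (hbdd : ∀ z θ, Fmin ≤ f z θ ∧ f z θ ≤ Fmax) {s : Param d × ℝ}
    (hs : s.2 ∈ Set.Icc Fmin Fmax) :
    weightedGradSq f x t s
      ≤ Real.exp (t * (Fmax - Fmin)) * ‖gradient (tiltedLoss f x t) s.1‖ ^ 2 := by
  refine mul_le_mul_of_nonneg_right (Real.exp_le_exp.2 ?_) (by positivity)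
  have := (tiltedLoss_mem_Icc (x := x) ht hbdd s.1).1
  rw [← mul_sub]
  exact mul_le_mul_of_nonneg_left (by linarith [hs.2]) ht.le

/-- Since `exp (3/4) ≥ 1 + 3/4 + 9/32 > 2`. The form `e/2` is chosen so that, with the doubling of
the squared gradient, the loss is a factor `e`, matching `1 - λ = 1/(2e)`. -/
theorem exp_quarter_le : Real.exp (1 / 4) ≤ Real.exp 1 / 2 := by
  have h1 : Real.exp 1 = Real.exp (1 / 4) * Real.exp (3 / 4) := by
    rw [← Real.exp_add]; norm_num
  have h2 := Real.quadratic_le_exp_of_nonneg (x := 3 / 4) (by norm_num)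
  rw [h1]
  nlinarith [Real.exp_pos (1 / 4)]

/-- The change of the potential in one iteration with the samples `i` and `j`. -/
theorem potential_iteration_le [NeZero N] (ht : 0 < t) (hα : 0 < α) (hB : 0 < B) (hβ : 0 < β)
    (hbdd : ∀ z θ, Fmin ≤ f z θ ∧ f z θ ≤ Fmax)
    (hdiff : ∀ i, Differentiable ℝ (f (x i)))
    (hsmooth : LipschitzWith β (gradient (tiltedLoss f x t)))
    (hgrad : ∀ i θ, ‖stochGrad f x t i θ‖ ≤ B)
    (hstep : t * (Real.sqrt (2 * β * (Fmax - Fmin))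
      * (α * B * Real.exp (t * (Fmax - Fmin)))) ≤ 1 / 4)
    {s : Param d × ℝ} (hs : s.2 ∈ Set.Icc Fmin Fmax) (i j : Fin N) :
    let ρ := estimateUpdate f x t averagingWeight {j} s.1 s.2
    let R := tiltedLoss f x t s.1
    let g := gradient (tiltedLoss f x t) s.1
    potential f x t α (iteration f x t averagingWeight α {i} {j} s)
      ≤ R + potentialError t B (Fmax - Fmin) α β
        + α * Real.exp 1 / 8 * Real.exp (t * ρ - t * R) * ‖g‖ ^ 2
        - α * Real.exp (t * R - t * ρ) * inner ℝ g (stochGrad f x t i s.1) := by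
  intro ρ R g
  set θ' := paramUpdate f x t α {i} s.1 ρ with hθ'
  set w := Real.exp (t * R - t * ρ) with hw
  set z := Real.exp (t * ρ - t * R) with hz
  set Δ := Fmax - Fmin with hΔ
  set h := stochGrad f x t i s.1 with hh
  have hwpos : 0 < w := Real.exp_pos _
  have hzpos : 0 < z := Real.exp_pos _
  have hzw : z * w = 1 := by
    rw [hw, hz, ← Real.exp_add]; simp
  have hd := differentiable_tiltedLoss (f := f) (x := x) ht hdiff
  have hR := tiltedLoss_mem_Icc (f := f) (x := x) ht hbdd
  have hρ : ρ ∈ Set.Icc Fmin Fmax :=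
    estimateUpdate_mem_Icc ht averagingWeight_nonneg averagingWeight_lt_one hbdd j s.1 hs
  have hw_le : w ≤ Real.exp (t * Δ) := by
    refine Real.exp_le_exp.2 ?_
    rw [← mul_sub]
    exact mul_le_mul_of_nonneg_left (by linarith [hρ.1, (hR s.1).2]) ht.le
  have hθ : θ' = s.1 + -(α * w) • h := by
    rw [hθ', paramUpdate_singleton, sub_eq_add_neg, neg_smul]
  have hdist : ‖-(α * w) • h‖ ≤ α * B * w := by
    rw [norm_smul, norm_neg, Real.norm_of_nonneg (by positivity)]
    calc α * w * ‖h‖ ≤ α * w * B := by gcongr; exact hgrad i s.1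
      _ = _ := by ring
  have hdist' : ‖-(α * w) • h‖ ≤ α * B * Real.exp (t * Δ) := hdist.trans (by gcongr)
  have hloss : tiltedLoss f x t θ' ≤ R - α * w * inner ℝ g h
      + β / 2 * (α * B * Real.exp (t * Δ)) ^ 2 := by
    have h1 := le_quadratic_of_lipschitz_gradient hd hsmooth s.1 (-(α * w) • h)
    rw [← hθ, real_inner_smul_right] at h1
    have h2 : (β : ℝ) / 2 * ‖-(α * w) • h‖ ^ 2
        ≤ β / 2 * (α * B * Real.exp (t * Δ)) ^ 2 := by gcongr
    linarith
  -- By `hstep` one move lowers `t` times the loss by at most `1/4`, so the weight grows at most by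
  -- `exp (1/4)`.
  have hfactor : Real.exp (t * ρ - t * tiltedLoss f x t θ') ≤ z * (Real.exp 1 / 2) := by
    have hC : ∀ y, ‖gradient (tiltedLoss f x t) y‖ ≤ Real.sqrt (2 * β * Δ) := fun y =>
      Real.le_sqrt_of_sq_le (norm_gradient_sq_le_of_mem_Icc hd hsmooth hβ hR y)
    have h1 := sub_le_mul_norm_sub_of_norm_gradient_le hd hC s.1 θ'
    have h2 : ‖s.1 - θ'‖ ≤ α * B * Real.exp (t * Δ) := by
      rw [norm_sub_rev, hθ, add_sub_cancel_left]; exact hdist'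
    have h3 : t * (R - tiltedLoss f x t θ') ≤ 1 / 4 := by
      refine le_trans (mul_le_mul_of_nonneg_left (h1.trans ?_) ht.le) hstep
      gcongr
    calc Real.exp (t * ρ - t * tiltedLoss f x t θ')
        = z * Real.exp (t * (R - tiltedLoss f x t θ')) := by
          rw [hz, ← Real.exp_add]; congr 1; ring
      _ ≤ z * Real.exp (1 / 4) := by gcongr
      _ ≤ _ := by gcongr; exact exp_quarter_le
  have hgr : ‖gradient (tiltedLoss f x t) θ'‖ ^ 2
      ≤ 2 * ‖g‖ ^ 2 + 2 * β ^ 2 * (α * B * w) ^ 2 := by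
    refine (norm_gradient_sq_le_of_lipschitz hsmooth s.1 θ').trans ?_
    rw [hθ, add_sub_cancel_left]
    gcongr
  have hweighted : weightedGradSq f x t (θ', ρ)
      ≤ Real.exp 1 / 2 * (2 * z * ‖g‖ ^ 2 + 2 * β ^ 2 * (α * B) ^ 2 * Real.exp (t * Δ)) := by
    calc weightedGradSq f x t (θ', ρ)
        ≤ z * (Real.exp 1 / 2) * (2 * ‖g‖ ^ 2 + 2 * β ^ 2 * (α * B * w) ^ 2) := by
          unfold weightedGradSq
          gcongr
      -- One factor `w` of the squared step cancels against `z`, so this error carries `exp (tΔ)`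
      -- only once.
      _ = Real.exp 1 / 2 * (2 * z * ‖g‖ ^ 2 + 2 * β ^ 2 * (α * B) ^ 2 * (z * w * w)) := by ring
      _ ≤ _ := by
          rw [hzw, one_mul]
          gcongr
  have hpot : potential f x t α (iteration f x t averagingWeight α {i} {j} s)
      = tiltedLoss f x t θ' + α / 8 * weightedGradSq f x t (θ', ρ) := rfl
  have h4 := mul_le_mul_of_nonneg_left hweighted (show 0 ≤ α / 8 by positivity)
  rw [hpot, potentialError]
  linarith

theorem sum_inner_stochGrad [NeZero N] (ht : 0 < t)
    (hdiff : ∀ i, Differentiable ℝ (f (x i))) (θ : Param d) :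
    ∑ i, inner ℝ (gradient (tiltedLoss f x t) θ) (stochGrad f x t i θ)
      = N * ‖gradient (tiltedLoss f x t) θ‖ ^ 2 := by
  have hN : (N : ℝ) ≠ 0 := Nat.cast_ne_zero.2 (NeZero.ne N)
  have h : ∑ i, stochGrad f x t i θ = (N : ℝ) • gradient (tiltedLoss f x t) θ := by
    rw [gradient_tiltedLoss ht hdiff, smul_smul, mul_one_div_cancel hN, one_smul]
  rw [← inner_sum, h, real_inner_smul_right, real_inner_self_eq_norm_sq]

/-- The sampled exponential loss has mean `exp (tR)`, so averaging contracts the relative error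
towards `1` by the factor `1 - λ`. -/
theorem sum_exp_estimateUpdate [NeZero N] (ht : 0 < t) (θ : Param d) (ρ : ℝ) :
    ∑ j : Fin N, Real.exp (t * estimateUpdate f x t averagingWeight {j} θ ρ
        - t * tiltedLoss f x t θ)
      = N * ((1 - averagingWeight) * Real.exp (t * ρ - t * tiltedLoss f x t θ)
        + averagingWeight) := by
  have hN : (N : ℝ) ≠ 0 := Nat.cast_ne_zero.2 (NeZero.ne N)
  have hexp := exp_mul_tiltedLoss (f := f) (x := x) ht θ
  have hsum : ∑ i, Real.exp (t * f (x i) θ) = N * Real.exp (t * tiltedLoss f x t θ) := by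
    rw [hexp]; field_simp
  have hne := (Real.exp_pos (t * tiltedLoss f x t θ)).ne'
  simp only [Real.exp_sub,
    exp_mul_estimateUpdate ht averagingWeight_nonneg averagingWeight_lt_one]
  rw [← Finset.sum_div, Finset.sum_add_distrib, ← Finset.mul_sum, ← Finset.mul_sum, hsum]
  simp only [Finset.sum_const, Finset.card_univ, Fintype.card_fin, nsmul_eq_mul]
  field_simp

/-- In mean over the two samples, an iteration decreases the potential by a multiple of the
squared gradient, up to the error term. -/
theorem sum_potential_iteration_le [NeZero N] (ht : 0 < t) (hα : 0 < α) (hB : 0 < B)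
    (hβ : 0 < β)
    (hbdd : ∀ z θ, Fmin ≤ f z θ ∧ f z θ ≤ Fmax)
    (hdiff : ∀ i, Differentiable ℝ (f (x i)))
    (hsmooth : LipschitzWith β (gradient (tiltedLoss f x t)))
    (hgrad : ∀ i θ, ‖stochGrad f x t i θ‖ ≤ B)
    (hstep : t * (Real.sqrt (2 * β * (Fmax - Fmin))
      * (α * B * Real.exp (t * (Fmax - Fmin)))) ≤ 1 / 4)
    {s : Param d × ℝ} (hs : s.2 ∈ Set.Icc Fmin Fmax) :
    (1 / (N : ℝ) ^ 2) * ∑ j, ∑ i,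
        potential f x t α (iteration f x t averagingWeight α {i} {j} s)
      ≤ potential f x t α s - α / 2 * ‖gradient (tiltedLoss f x t) s.1‖ ^ 2
        + potentialError t B (Fmax - Fmin) α β := by
  have hN : (0 : ℝ) < N := Nat.cast_pos.2 (NeZero.pos N)
  set R := tiltedLoss f x t s.1 with hR
  set G := ‖gradient (tiltedLoss f x t) s.1‖ ^ 2 with hG
  set E := potentialError t B (Fmax - Fmin) α β with hE
  set u := Real.exp (t * s.2 - t * R) with hu
  have hGnn : 0 ≤ G := by positivity
  have hinner : ∀ j : Fin N,
      ∑ i, potential f x t α (iteration f x t averagingWeight α {i} {j} s)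
        ≤ N * (R + E - α * G) + N * (α * (Real.exp 1 / 8 + 1 / 4) * G)
          * Real.exp (t * estimateUpdate f x t averagingWeight {j} s.1 s.2 - t * R) := by
    intro j
    set ρ := estimateUpdate f x t averagingWeight {j} s.1 s.2 with hρ
    set w := Real.exp (t * R - t * ρ) with hw
    set z := Real.exp (t * ρ - t * R) with hz
    have hzpos : 0 < z := Real.exp_pos _
    have hzw : w = 1 / z := by
      rw [hw, hz, one_div, ← Real.exp_neg]; congr 1; ring
    -- AM–GM for `1/z + z/4`: it trades the reciprocal `w` for `z`, whose mean over `j` is known.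
    have hwz : 1 - z / 4 ≤ w := by
      rw [hzw, le_div_iff₀ hzpos]
      nlinarith [sq_nonneg (z - 2)]
    have h1 := Finset.sum_le_sum fun i (_ : i ∈ Finset.univ) =>
      potential_iteration_le ht hα hB hβ hbdd hdiff hsmooth hgrad hstep hs i j
    rw [Finset.sum_sub_distrib, ← Finset.mul_sum, sum_inner_stochGrad ht hdiff] at h1
    simp only [Finset.sum_const, Finset.card_univ, Fintype.card_fin, nsmul_eq_mul] at h1
    refine h1.trans ?_
    have h2 : α * (N * G) * (1 - z / 4) ≤ α * (N * G) * w :=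
      mul_le_mul_of_nonneg_left hwz (by positivity)
    simp only [← hR, ← hG, ← hE, ← hρ, ← hw, ← hz]
    linarith
  have hmain : ∑ j : Fin N, ∑ i : Fin N,
      potential f x t α (iteration f x t averagingWeight α {i} {j} s)
        ≤ (N : ℝ) ^ 2 * (R + E - α * G + α * (Real.exp 1 / 8 + 1 / 4) * G
          * ((1 - averagingWeight) * u + averagingWeight)) := by
    refine (Finset.sum_le_sum fun j _ => hinner j).trans (le_of_eq ?_)
    rw [Finset.sum_add_distrib, ← Finset.mul_sum, ← Finset.mul_sum, sum_exp_estimateUpdate ht]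
    simp only [Finset.sum_const, Finset.card_univ, Fintype.card_fin, nsmul_eq_mul]
    ring
  rw [one_div, ← div_eq_inv_mul, div_le_iff₀ (by positivity), mul_comm _ ((N : ℝ) ^ 2)]
  refine hmain.trans (mul_le_mul_of_nonneg_left ?_ (by positivity))
  have he := Real.exp_one_gt_d9
  have he' := Real.exp_one_lt_d9
  have hinv1 : 1 / Real.exp 1 ≤ 1 / 2 := by
    apply one_div_le_one_div_of_le <;> linarith
  have hinv2 : 1 / 4 ≤ 1 / Real.exp 1 := by
    apply one_div_le_one_div_of_le <;> linarith
  -- The factor `e/8` comes from the new weighted gradient, `1/4` from AM–GM. The bound `1/8`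
  -- restores the weight in the potential; `c2` leaves half of the decrease `α‖g‖²`.
  have c1 : (Real.exp 1 / 8 + 1 / 4) * (1 - averagingWeight) ≤ 1 / 8 := by
    have : (Real.exp 1 / 8 + 1 / 4) * (1 - averagingWeight)
        = 1 / 16 + 1 / 8 * (1 / Real.exp 1) := by
      rw [averagingWeight]; field_simp; ring
    rw [this]; linarith
  have c2 : (Real.exp 1 / 8 + 1 / 4) * averagingWeight ≤ 1 / 2 := by
    have : (Real.exp 1 / 8 + 1 / 4) * averagingWeight
        = Real.exp 1 / 8 + 3 / 16 - 1 / 8 * (1 / Real.exp 1) := by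
      rw [averagingWeight]; field_simp; ring
    rw [this]; linarith
  have hupos : 0 < u := Real.exp_pos _
  have d1 := mul_le_mul_of_nonneg_left c1 (show 0 ≤ α * G * u by positivity)
  have d2 := mul_le_mul_of_nonneg_left c2 (show 0 ≤ α * G by positivity)
  have hpot : potential f x t α s = R + α / 8 * (u * G) := rfl
  rw [hpot]
  linarith

end Potential

/-! ### Averaging over independent uniform samples. -/

section Sampling

variable {Ω : Type*} [MeasurableSpace Ω] {μ : Measure Ω} [IsProbabilityMeasure μ]

/-- Averaging over a uniform random variable with finitely many values that is independent
of a discrete one. -/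
theorem integral_eq_mean_of_indepFun {A C : Type*} [Finite A] [MeasurableSpace A]
    [MeasurableSingletonClass A] [Fintype C] [MeasurableSpace C] [MeasurableSingletonClass C]
    {X : Ω → A} {Y : Ω → C} (hX : Measurable X) (hY : Measurable Y) (hXY : IndepFun X Y μ)
    {p : ℝ≥0∞} (hp : ∀ c, μ {ω | Y ω = c} = p) (φ : A → C → ℝ) :
    ∫ ω, φ (X ω) (Y ω) ∂μ = p.toReal * ∑ c, ∫ ω, φ (X ω) c ∂μ := by
  classical
  have hint : ∀ ψ : A × C → ℝ, Integrable (fun ω => ψ (X ω, Y ω)) μ := fun ψ =>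
    (Integrable.of_finite (μ := μ.map fun ω => (X ω, Y ω)) (f := ψ)).comp_measurable
      (hX.prodMk hY)
  -- Splitting by the value of `Y` makes every summand a product of independent factors.
  have h1 : ∀ ω, φ (X ω) (Y ω) = ∑ c, φ (X ω) c * (if Y ω = c then 1 else 0) := by
    intro ω; simp
  simp_rw [h1]
  rw [integral_finsetSum _ fun c _ => hint fun q => φ q.1 c * (if q.2 = c then 1 else 0),
    Finset.mul_sum]
  refine Finset.sum_congr rfl fun c _ => ?_
  have h2 := hXY.integral_fun_comp_mul_comp hX.aemeasurable hY.aemeasurable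
    (f := fun a => φ a c) (g := fun y => if y = c then (1 : ℝ) else 0)
    (measurable_of_finite _).aestronglyMeasurable (measurable_of_finite _).aestronglyMeasurable
  have h3 : ∫ ω, (if Y ω = c then (1 : ℝ) else 0) ∂μ = p.toReal := by
    have hm : MeasurableSet {ω | Y ω = c} := hY (measurableSet_singleton c)
    rw [← hp c, ← measureReal_def, ← integral_indicator_one hm]
    rfl
  rw [h2, h3, mul_comm]

variable {ι C : Type*} [Fintype C] [MeasurableSpace C] [MeasurableSingletonClass C]
  {Z : ι → Ω → C}

/-- Finitely many coordinates with finitely many values give a simple random variable, so `φ` needs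
no regularity. -/
theorem integrable_of_dependsOn (hZ : ∀ i, Measurable (Z i)) {S : Finset ι}
    {φ : (ι → C) → ℝ} (hφ : DependsOn φ (S : Set ι)) :
    Integrable (fun ω => φ fun i => Z i ω) μ := by
  obtain ⟨ψ, rfl⟩ := dependsOn_iff_exists_comp.1 hφ
  have hX : Measurable fun ω (i : (S : Set ι)) => Z i ω := measurable_pi_lambda _ fun i => hZ i
  exact (Integrable.of_finite (μ := μ.map fun ω (i : (S : Set ι)) => Z i ω)
    (f := ψ)).comp_measurable hX

/-- Averaging over one of independent, uniformly distributed samples. -/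
theorem integral_eq_mean_of_dependsOn (hZ : ∀ i, Measurable (Z i))
    (hind : iIndepFun Z μ) {p : ℝ≥0∞} (hp : ∀ i c, μ {ω | Z i ω = c} = p)
    {S : Finset ι} {k : ι} (hk : k ∉ S) {φ : (ι → C) → C → ℝ}
    (hφ : DependsOn φ (S : Set ι)) :
    ∫ ω, φ (fun i => Z i ω) (Z k ω) ∂μ = p.toReal * ∑ c, ∫ ω, φ (fun i => Z i ω) c ∂μ := by
  obtain ⟨ψ, rfl⟩ := dependsOn_iff_exists_comp.1 hφ
  have h := hind.indepFun_finset S {k} (Finset.disjoint_singleton_right.2 hk) hZ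
  have h' : IndepFun (fun ω (i : S) => Z i ω) (Z k) μ :=
    h.comp measurable_id (measurable_pi_apply (⟨k, Finset.mem_singleton_self k⟩ : ({k} : Finset ι)))
  exact integral_eq_mean_of_indepFun (X := fun ω (i : S) => Z i ω)
    (measurable_pi_lambda _ fun i => hZ i) (hZ k) h' (hp k) ψ

end Sampling

/-! ### Expectations along the solver. -/

section Solver

variable {𝒳 : Type*} {N d : ℕ} {f : 𝒳 → Param d → ℝ} {x : Fin N → 𝒳}
  {t B Fmin Fmax : ℝ} {β : ℝ≥0}

/-- The state after `n` iterations as a function of the sampled indices, where `a (.inl k)` is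
the sample for the parameter and `a (.inr k)` the one for the estimate in iteration `k`. -/
def sampledState (f : 𝒳 → Param d → ℝ) (x : Fin N → 𝒳) (t lam : ℝ) (α : ℕ → ℝ)
    (θ₁ : Param d) (n : ℕ) (a : ℕ ⊕ ℕ → Fin N) : Param d × ℝ :=
  state f x t lam α (fun j => {a (.inl j)}) (fun j => {a (.inr j)}) θ₁ n

theorem sampledState_succ (lam : ℝ) (α : ℕ → ℝ) (θ₁ : Param d) (n : ℕ) (a : ℕ ⊕ ℕ → Fin N) :
    sampledState f x t lam α θ₁ (n + 1) a
      = iteration f x t lam (α (n + 1)) {a (.inl (n + 1))} {a (.inr (n + 1))}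
          (sampledState f x t lam α θ₁ n a) :=
  rfl

/-- The samples that are used in the first `n` iterations. -/
def samplesUpTo (n : ℕ) : Finset (ℕ ⊕ ℕ) := (Finset.range (n + 1)).disjSum (Finset.range (n + 1))

theorem dependsOn_sampledState (lam : ℝ) (α : ℕ → ℝ) (θ₁ : Param d) (n : ℕ) :
    DependsOn (sampledState f x t lam α θ₁ n) (samplesUpTo n : Set (ℕ ⊕ ℕ)) := by
  induction n with
  | zero => intro a b _; rfl
  | succ n ih =>
    intro a b hab
    have h1 : sampledState f x t lam α θ₁ n a = sampledState f x t lam α θ₁ n b :=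
      ih fun i hi => hab i (by
        rcases i with i | i <;> simp [samplesUpTo] at hi ⊢ <;> omega)
    rw [sampledState_succ, sampledState_succ, h1, hab (.inl (n + 1)) (by simp [samplesUpTo]),
      hab (.inr (n + 1)) (by simp [samplesUpTo])]

theorem sampledState_snd_mem_Icc [NeZero N] (ht : 0 < t)
    (hbdd : ∀ z θ, Fmin ≤ f z θ ∧ f z θ ≤ Fmax) (α : ℕ → ℝ) (θ₁ : Param d) (n : ℕ)
    (a : ℕ ⊕ ℕ → Fin N) :
    (sampledState f x t averagingWeight α θ₁ n a).2 ∈ Set.Icc Fmin Fmax := by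
  induction n with
  | zero => exact tiltedLoss_mem_Icc ht hbdd θ₁
  | succ n ih =>
    exact estimateUpdate_mem_Icc ht averagingWeight_nonneg averagingWeight_lt_one hbdd _ _ ih

variable {Ω : Type*} [MeasurableSpace Ω] {μ : Measure Ω} [IsProbabilityMeasure μ]
  {Z : ℕ ⊕ ℕ → Ω → Fin N}

theorem integrable_sampledState (hZ : ∀ i, Measurable (Z i)) (lam : ℝ) (α : ℕ → ℝ)
    (θ₁ : Param d) (n : ℕ) (Φ : Param d × ℝ → ℝ) :
    Integrable (fun ω => Φ (sampledState f x t lam α θ₁ n fun i => Z i ω)) μ :=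
  integrable_of_dependsOn (φ := fun a => Φ (sampledState f x t lam α θ₁ n a)) hZ
    fun _ _ hab => congrArg Φ (dependsOn_sampledState lam α θ₁ n hab)

/-- The Markov property of the solver: the samples of an iteration may be averaged out. -/
theorem integral_sampledState_succ [NeZero N] (hZ : ∀ i, Measurable (Z i)) (hind : iIndepFun Z μ)
    (hunif : ∀ k i, μ {ω | Z k ω = i} = (N : ℝ≥0∞)⁻¹) (lam : ℝ) (α : ℕ → ℝ)
    (θ₁ : Param d) (n : ℕ) (Φ : Param d × ℝ → ℝ) :
    ∫ ω, Φ (sampledState f x t lam α θ₁ (n + 1) fun i => Z i ω) ∂μ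
      = ∫ ω, (1 / (N : ℝ) ^ 2) * ∑ j, ∑ i, Φ (iteration f x t lam (α (n + 1)) {i} {j}
          (sampledState f x t lam α θ₁ n fun i => Z i ω)) ∂μ := by
  classical
  have hdep := dependsOn_sampledState (f := f) (x := x) (t := t) lam α θ₁ n
  have hl : Sum.inl (n + 1) ∉ insert (Sum.inr (n + 1)) (samplesUpTo n) := by
    simp [samplesUpTo]
  have hr : Sum.inr (n + 1) ∉ samplesUpTo n := by simp [samplesUpTo]
  -- The parameter sample is averaged out first, conditionally on the past and the estimate sample
  -- of the same iteration; `h2` then averages out the latter.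
  have h1 := integral_eq_mean_of_dependsOn hZ hind hunif hl
    (φ := fun a c => Φ (iteration f x t lam (α (n + 1)) {c} {a (.inr (n + 1))}
      (sampledState f x t lam α θ₁ n a)))
    (by
      intro a b hab
      have e1 : sampledState f x t lam α θ₁ n a = sampledState f x t lam α θ₁ n b :=
        hdep fun i hi => hab i (Finset.mem_coe.2 (Finset.mem_insert_of_mem hi))
      funext c
      simp only [e1, hab (.inr (n + 1)) (Finset.mem_coe.2 (Finset.mem_insert_self _ _))])
  have h2 : ∀ c : Fin N, _ := fun c => integral_eq_mean_of_dependsOn hZ hind hunif hr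
    (φ := fun a c' => Φ (iteration f x t lam (α (n + 1)) {c} {c'}
      (sampledState f x t lam α θ₁ n a)))
    (by
      intro a b hab
      funext c'
      simp only [hdep hab])
  have hint : ∀ i j : Fin N, Integrable (fun ω => Φ (iteration f x t lam (α (n + 1)) {i} {j}
      (sampledState f x t lam α θ₁ n fun i => Z i ω))) μ := fun i j =>
    integrable_sampledState hZ lam α θ₁ n
      fun s => Φ (iteration f x t lam (α (n + 1)) {i} {j} s)
  simp only [sampledState_succ]
  rw [h1, integral_const_mul, integral_finsetSum _ fun j _ => integrable_finsetSum _ fun i _ =>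
    hint i j]
  simp_rw [h2, integral_finsetSum _ fun i _ => hint i _]
  rw [← Finset.mul_sum, Finset.sum_comm, ← mul_assoc, ENNReal.toReal_inv, ENNReal.toReal_natCast]
  congr 1
  rw [one_div, sq, mul_inv]

/-- The squared gradients along the solver, summed over a range of iterations with a constant
step size. -/
theorem sum_integral_norm_gradient_sq_le [NeZero N] (ht : 0 < t) (hB : 0 < B) (hβ : 0 < β)
    (hbdd : ∀ z θ, Fmin ≤ f z θ ∧ f z θ ≤ Fmax)
    (hdiff : ∀ i, Differentiable ℝ (f (x i)))
    (hsmooth : LipschitzWith β (gradient (tiltedLoss f x t)))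
    (hgrad : ∀ i θ, ‖stochGrad f x t i θ‖ ≤ B)
    (hZ : ∀ i, Measurable (Z i)) (hind : iIndepFun Z μ)
    (hunif : ∀ k i, μ {ω | Z k ω = i} = (N : ℝ≥0∞)⁻¹)
    (θ₁ : Param d) {α : ℕ → ℝ} {α₀ : ℝ} (hα₀ : 0 < α₀) {m n : ℕ} (hmn : m ≤ n)
    (hα : ∀ k, m ≤ k → α (k + 1) = α₀)
    (hstep : t * (Real.sqrt (2 * β * (Fmax - Fmin))
      * (α₀ * B * Real.exp (t * (Fmax - Fmin)))) ≤ 1 / 4) :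
    α₀ / 2 * ∑ k ∈ Finset.Ico m n, ∫ ω, ‖gradient (tiltedLoss f x t)
        (sampledState f x t averagingWeight α θ₁ k fun i => Z i ω).1‖ ^ 2 ∂μ
      ≤ (Fmax - Fmin) + α₀ / 8 * (Real.exp (t * (Fmax - Fmin)) * (2 * β * (Fmax - Fmin)))
        + (n - m : ℕ) * potentialError t B (Fmax - Fmin) α₀ β := by
  set S : ℕ → Ω → Param d × ℝ := fun k ω =>
    sampledState f x t averagingWeight α θ₁ k fun i => Z i ω with hS
  have hint : ∀ k (Φ : Param d × ℝ → ℝ), Integrable (fun ω => Φ (S k ω)) μ := fun k Φ =>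
    integrable_sampledState hZ _ α θ₁ k Φ
  have hSmem : ∀ k ω, (S k ω).2 ∈ Set.Icc Fmin Fmax := fun k ω =>
    sampledState_snd_mem_Icc ht hbdd α θ₁ k _
  have hR := tiltedLoss_mem_Icc (f := f) (x := x) ht hbdd
  have hone : ∀ k, m ≤ k → ∫ ω, potential f x t α₀ (S (k + 1) ω) ∂μ
      ≤ ∫ ω, potential f x t α₀ (S k ω) ∂μ
        - α₀ / 2 * ∫ ω, ‖gradient (tiltedLoss f x t) (S k ω).1‖ ^ 2 ∂μ
        + potentialError t B (Fmax - Fmin) α₀ β := by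
    intro k hk
    have h1 := integral_sampledState_succ (f := f) (x := x) (t := t) hZ hind hunif
      averagingWeight α θ₁ k (potential f x t α₀)
    rw [hα k hk] at h1
    have hi1 := hint k (potential f x t α₀)
    have hi2 := (hint k fun s => ‖gradient (tiltedLoss f x t) s.1‖ ^ 2).const_mul (α₀ / 2)
    calc ∫ ω, potential f x t α₀ (S (k + 1) ω) ∂μ = _ := h1
      _ ≤ ∫ ω, (potential f x t α₀ (S k ω)
            - α₀ / 2 * ‖gradient (tiltedLoss f x t) (S k ω).1‖ ^ 2
            + potentialError t B (Fmax - Fmin) α₀ β) ∂μ := by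
          refine integral_mono (hint k fun s => (1 / (N : ℝ) ^ 2) * ∑ j, ∑ i, potential f x t α₀
            (iteration f x t averagingWeight α₀ {i} {j} s))
            ((hi1.sub hi2).add (integrable_const _)) fun ω => ?_
          exact sum_potential_iteration_le ht hα₀ hB hβ hbdd hdiff hsmooth hgrad hstep (hSmem k ω)
      _ = _ := by
          have h2 := integral_add (hi1.sub hi2)
            (integrable_const (potentialError t B (Fmax - Fmin) α₀ β))
          simp only [Pi.sub_apply, integral_const, probReal_univ, one_smul] at h2
          rw [h2, integral_sub hi1 hi2, integral_const_mul]
  have htel : α₀ / 2 * ∑ k ∈ Finset.Ico m n, ∫ ω, ‖gradient (tiltedLoss f x t) (S k ω).1‖ ^ 2 ∂μ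
      ≤ ∫ ω, potential f x t α₀ (S m ω) ∂μ - ∫ ω, potential f x t α₀ (S n ω) ∂μ
        + (n - m : ℕ) * potentialError t B (Fmax - Fmin) α₀ β := by
    induction n, hmn using Nat.le_induction with
    | base => simp
    | succ n hmn ih =>
      rw [Finset.sum_Ico_succ_top hmn, Nat.succ_sub hmn, mul_add]
      push_cast
      linarith [hone n hmn]
  -- Holds at any time `m`, since the estimate always stays in `[Fmin, Fmax]`: no accuracy of the
  -- estimate is needed.
  have hupper : ∫ ω, potential f x t α₀ (S m ω) ∂μ
      ≤ Fmax + α₀ / 8 * (Real.exp (t * (Fmax - Fmin)) * (2 * β * (Fmax - Fmin))) := by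
    calc _ ≤ ∫ _ω, (Fmax + α₀ / 8
          * (Real.exp (t * (Fmax - Fmin)) * (2 * β * (Fmax - Fmin)))) ∂μ := by
          refine integral_mono (hint m _) (integrable_const _) fun ω => ?_
          refine add_le_add (hR _).2 (mul_le_mul_of_nonneg_left ?_ (by positivity))
          refine (weightedGradSq_le ht hbdd (hSmem m ω)).trans ?_
          gcongr
          exact norm_gradient_sq_le_of_mem_Icc (differentiable_tiltedLoss ht hdiff) hsmooth hβ hR _
      _ = _ := by simp
  have hlower : Fmin ≤ ∫ ω, potential f x t α₀ (S n ω) ∂μ := by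
    calc Fmin = ∫ _ω, Fmin ∂μ := by simp
      _ ≤ _ := by
          refine integral_mono (integrable_const _) (hint n _) fun ω => ?_
          have h1 := (hR (S n ω).1).1
          have h2 := weightedGradSq_nonneg (f := f) (x := x) (t := t) (S n ω)
          have h3 : 0 ≤ α₀ / 8 * weightedGradSq f x t (S n ω) := by positivity
          simp only [potential]
          linarith
  linarith

end Solver

/-! ### Choice of the step size and numerical constants. -/

/-- The step size balances the decrease of the potential and its error: the bound for the sum
`T` of the squared gradients. Here `a = √Δ`, `b = √β`, `r = √K` and `E = exp (t Δ)`. -/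
theorem sum_le_of_balanced_step {t a b r B T α : ℝ} {n : ℕ} (ha : 0 < a) (hb : 0 < b)
    (hr : 0 < r) (hB : 0 < B) (ht : 0 < t) (hn : (n : ℝ) ≤ r ^ 2)
    (hα : α = Real.sqrt 2 * a / (Real.exp (t * a ^ 2) * (b * B * r)))
    (hrB : 2 * Real.sqrt 2 * Real.exp (t * a ^ 2 + 1) * (b * a) ≤ B * r)
    (h : α / 2 * T ≤ a ^ 2 + α / 8 * (Real.exp (t * a ^ 2) * (2 * b ^ 2 * a ^ 2))
      + n * potentialError t B (a ^ 2) α (b ^ 2)) :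
    T / r ^ 2 ≤ 2 * Real.sqrt 2 * B * Real.exp (t * a ^ 2 + 1) * (b * a / r) := by
  set E := Real.exp (t * a ^ 2) with hE
  set c := Real.sqrt 2 with hc
  have hc2 : c ^ 2 = 2 := Real.sq_sqrt (by norm_num)
  have hcpos : 0 < c := Real.sqrt_pos.2 (by norm_num)
  have hEpos : 0 < E := Real.exp_pos _
  have hE1 : 1 ≤ E := Real.one_le_exp (by positivity)
  have hαpos : 0 < α := by rw [hα]; positivity
  have he := Real.exp_one_gt_d9
  have he' := Real.exp_one_lt_d9
  have hEe : Real.exp (t * a ^ 2 + 1) = E * Real.exp 1 := Real.exp_add _ _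
  have hprod : α * (E * (b * B * r)) = c * a := by
    rw [hα]; field_simp
  -- Thus over `K = r ^ 2` iterations the leading error `β/2 (αBE)²` adds up to exactly `Δ = a ^ 2`.
  have hsq : (α * B * E) ^ 2 * (b ^ 2 * r ^ 2) = 2 * a ^ 2 := by
    have : (α * B * E) ^ 2 * (b ^ 2 * r ^ 2) = (α * (E * (b * B * r))) ^ 2 := by ring
    rw [this, hprod, mul_pow, hc2]
  have hsmall : α * b ^ 2 * E ≤ 1 := by
    rw [hEe] at hrB
    have h1 : 1 * 1 ≤ E * Real.exp 1 := by gcongr; linarith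
    have h2 : c * (b * a) ≤ B * r := by
      refine le_trans ?_ hrB
      have : 0 < c * (b * a) := by positivity
      nlinarith
    have h3 : α * b ^ 2 * E * (B * r) = c * (b * a) := by
      calc α * b ^ 2 * E * (B * r) = b * (α * (E * (b * B * r))) := by ring
        _ = _ := by rw [hprod]; ring
    have h4 : α * b ^ 2 * E * (B * r) ≤ 1 * (B * r) := by rw [h3, one_mul]; exact h2
    exact le_of_mul_le_mul_right h4 (by positivity)
  have hsmall2 : α * b ^ 2 ≤ 1 := by
    refine le_trans ?_ hsmall
    exact le_mul_of_one_le_right (by positivity) hE1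
  have herr : n * potentialError t B (a ^ 2) α (b ^ 2) ≤ 2 * a ^ 2 := by
    have hpe : 0 ≤ potentialError t B (a ^ 2) α (b ^ 2) := by
      unfold potentialError; positivity
    have h1 : r ^ 2 * potentialError t B (a ^ 2) α (b ^ 2)
        = a ^ 2 + Real.exp 1 / 4 * (α * b ^ 2) * (1 / E) * a ^ 2 := by
      have h2 : potentialError t B (a ^ 2) α (b ^ 2) * r ^ 2
          = ((α * B * E) ^ 2 * (b ^ 2 * r ^ 2)) / 2
            + α * b ^ 2 * Real.exp 1 / 8 * ((α * B * E) ^ 2 * (b ^ 2 * r ^ 2)) * (1 / E) := by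
        simp only [potentialError, ← hE]
        field_simp
      rw [mul_comm, h2, hsq]
      ring
    have h3 : Real.exp 1 / 4 * (α * b ^ 2) * (1 / E) ≤ 1 * 1 * 1 := by
      gcongr
      · linarith
      · exact (div_le_one hEpos).2 hE1
    have h4 := mul_le_mul_of_nonneg_right h3 (sq_nonneg a)
    have h5 := mul_le_mul_of_nonneg_right hn hpe
    linarith
  -- The contributions are `a²` from the range, at most `a²/4` from the initial weighted gradient
  -- and `2a²` from the errors; `13/4 ≤ 2e`.
  have hT : α / 2 * T ≤ 2 * Real.exp 1 * a ^ 2 := by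
    have h1 : α / 8 * (E * (2 * b ^ 2 * a ^ 2)) = (α * b ^ 2 * E) * (a ^ 2 / 4) := by ring
    have h2 := mul_le_mul_of_nonneg_right hsmall (show 0 ≤ a ^ 2 / 4 by positivity)
    nlinarith [sq_nonneg a]
  rw [div_le_iff₀ (by positivity)]
  have h6 : α / 2 * (2 * c * B * Real.exp (t * a ^ 2 + 1) * (b * a / r) * r ^ 2)
      = 2 * Real.exp 1 * a ^ 2 := by
    calc _ = c * a * Real.exp 1 * (α * (E * (b * B * r))) := by
          rw [hEe]; field_simp
      _ = c ^ 2 * Real.exp 1 * a ^ 2 := by rw [hprod]; ring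
      _ = _ := by rw [hc2]
  exact le_of_mul_le_mul_left (hT.trans_eq h6.symm) (by positivity)

/-- The steps are short enough for the loss to change by a bounded factor only. -/
theorem step_le_quarter {t a b r B α : ℝ} (ha : 0 < a) (hb : 0 < b)
    (hr : 0 < r) (hB : 0 < B)
    (hα : α = Real.sqrt 2 * a / (Real.exp (t * a ^ 2) * (b * B * r)))
    (hrE : 2 * Real.exp (t * a ^ 2 + 1) ≤ r) :
    t * (Real.sqrt (2 * b ^ 2 * a ^ 2) * (α * B * Real.exp (t * a ^ 2))) ≤ 1 / 4 := by
  have hEpos := Real.exp_pos (t * a ^ 2)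
  have h1 : Real.sqrt (2 * b ^ 2 * a ^ 2) = Real.sqrt 2 * (b * a) := by
    rw [mul_assoc, Real.sqrt_mul (by norm_num), ← mul_pow, Real.sqrt_sq (by positivity)]
  have h2 : t * (Real.sqrt (2 * b ^ 2 * a ^ 2) * (α * B * Real.exp (t * a ^ 2)))
      = 2 * (t * a ^ 2) / r := by
    rw [h1, hα]
    field_simp
    rw [Real.sq_sqrt (by norm_num)]
  rw [h2, div_le_iff₀ hr]
  -- The claim is now `8tΔ ≤ r`; it follows from `exp (tΔ - 1) ≥ tΔ` and `e² ≥ 4`.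
  have h3 : Real.exp (t * a ^ 2 + 1) = Real.exp (t * a ^ 2 - 1) * Real.exp 1 * Real.exp 1 := by
    rw [← Real.exp_add, ← Real.exp_add]; congr 1; ring
  have h4 := Real.add_one_le_exp (t * a ^ 2 - 1)
  have he := Real.exp_one_gt_d9
  have h5 : Real.exp (t * a ^ 2 - 1) * 2 * 2 ≤ Real.exp (t * a ^ 2 + 1) := by
    rw [h3]; gcongr <;> linarith
  linarith

theorem gradient_tiltedLoss_eq_zero_of_lipschitz_zero {𝒳 : Type*} {N d : ℕ} [NeZero N]
    {f : 𝒳 → Param d → ℝ} {x : Fin N → 𝒳} {t : ℝ} (ht : 0 < t)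
    (hLip : ∀ i, LipschitzWith 0 (f (x i))) (hdiff : ∀ i, Differentiable ℝ (f (x i)))
    (θ : Param d) : gradient (tiltedLoss f x t) θ = 0 := by
  have h : ∀ i, gradient (f (x i)) θ = 0 := fun i => by
    have h1 : ‖fderiv ℝ (f (x i)) θ‖ ≤ 0 := by
      simpa using norm_fderiv_le_of_lipschitz ℝ (hLip i) (x₀ := θ)
    rw [gradient, norm_le_zero_iff.1 h1, map_zero]
  rw [gradient_tiltedLoss ht hdiff]
  simp [stochGrad, h]

end TERM
end

/-! ### The main theorem: vanishing burn-in, short horizons, long horizons. -/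

theorem mainTheorem10 {𝒳 : Type*} {N d : ℕ}
    (f : 𝒳 → TERM.Param d → ℝ) (x : Fin N → 𝒳)
    (t B Fmin Fmax : ℝ) (L β : ℝ≥0)
    (ht : 0 < t) (hB : 0 < B) (hβ : 0 < β)
    (hbdd : ∀ z θ, Fmin ≤ f z θ ∧ f z θ ≤ Fmax)
    (hLip : ∀ z, LipschitzWith L (f z))
    (hdiff : ∀ i, Differentiable ℝ (f (x i)))
    (hsmooth : LipschitzWith β (gradient (TERM.tiltedLoss f x t)))
    (hgrad : ∀ i θ, ‖TERM.stochGrad f x t i θ‖ ≤ B)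
    {Ω : Type*} [MeasurableSpace Ω] (μ : Measure Ω) [IsProbabilityMeasure μ]
    (ζ ξ : ℕ → Ω → Fin N)
    (hζ : ∀ k, Measurable (ζ k)) (hξ : ∀ k, Measurable (ξ k))
    (hζ_unif : ∀ k i, μ {ω | ζ k ω = i} = (N : ℝ≥0∞)⁻¹)
    (hξ_unif : ∀ k i, μ {ω | ξ k ω = i} = (N : ℝ≥0∞)⁻¹)
    (hindep : iIndepFun (Sum.elim ζ ξ) μ)
    (θ₁ : TERM.Param d) (K : ℕ) (hK1 : 1 ≤ K)
    (hK : TERM.burnIn t L β Fmin Fmax ≤ K) :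
    (1 / (K : ℝ)) * ∑ k ∈ Finset.Icc (TERM.burnIn t L β Fmin Fmax) K,
        ∫ ω, ‖gradient (TERM.tiltedLoss f x t)
          (TERM.iterate f x t TERM.averagingWeight (TERM.stepSize t L β B Fmin Fmax K)
            (fun j => {ζ j ω}) (fun j => {ξ j ω}) θ₁ k)‖ ^ 2 ∂μ
      ≤ Real.sqrt 8 * B * Real.exp (t * (Fmax - Fmin) + 1)
          * Real.sqrt (β * (Fmax - Fmin) / K) := by
  obtain ⟨ω₀⟩ : Nonempty Ω := nonempty_of_isProbabilityMeasure μ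
  -- The existence of a sample forces `N ≥ 1`.
  have i₀ : Fin N := ζ 0 ω₀
  have : NeZero N := ⟨(Nat.zero_lt_of_lt i₀.isLt).ne'⟩
  have hβ' : (0 : ℝ) < β := hβ
  have hKpos : (0 : ℝ) < K := Nat.cast_pos.2 hK1
  have hΔ0 : 0 ≤ Fmax - Fmin := by
    have := hbdd (x i₀) θ₁
    linarith
  have hR := TERM.tiltedLoss_mem_Icc (f := f) (x := x) ht hbdd
  have hgβ : ∀ θ, ‖gradient (TERM.tiltedLoss f x t) θ‖ ^ 2 ≤ 2 * β * (Fmax - Fmin) :=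
    TERM.norm_gradient_sq_le_of_mem_Icc (TERM.differentiable_tiltedLoss ht hdiff) hsmooth hβ hR
  have hgB := TERM.norm_gradient_tiltedLoss_le ht hdiff hgrad
  rcases Nat.eq_zero_or_pos (TERM.burnIn t L β Fmin Fmax) with h0 | hpos
  · have hzero : ∀ θ, gradient (TERM.tiltedLoss f x t) θ = 0 := by
      rw [TERM.burnIn, Nat.ceil_eq_zero] at h0
      have h1 : 0 ≤ 2 * (Fmax - Fmin) * t ^ 2 * (L : ℝ) ^ 2 / (β * Real.exp 1 ^ 2) := by
        positivity
      have h2 := le_antisymm h0 h1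
      have h3 : (β : ℝ) * Real.exp 1 ^ 2 ≠ 0 := by positivity
      have h4 : Fmax - Fmin = 0 ∨ L = 0 := by
        simpa [ht.ne', h3, hβ.ne'] using h2
      rcases h4 with h4 | h4
      · intro θ
        have := hgβ θ
        rw [h4, mul_zero] at this
        exact norm_eq_zero.1 (pow_eq_zero_iff two_ne_zero |>.1 (le_antisymm this (sq_nonneg _)))
      · subst h4
        exact TERM.gradient_tiltedLoss_eq_zero_of_lipschitz_zero ht (fun i => hLip _) hdiff
    simp only [hzero, norm_zero, ne_eq, OfNat.ofNat_ne_zero, not_false_eq_true, zero_pow,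
      integral_zero, Finset.sum_const_zero, mul_zero]
    positivity
  have hΔ : 0 < Fmax - Fmin := by
    refine lt_of_le_of_ne hΔ0 fun h => hpos.ne' ?_
    simp [TERM.burnIn, ← h]
  set m := TERM.burnIn t L β Fmin Fmax with hm
  have hcard : ((Finset.Icc m K).card : ℝ) ≤ K := by
    rw [Nat.card_Icc]; exact_mod_cast by omega
  obtain ⟨a, ha, ha2⟩ : ∃ a : ℝ, 0 < a ∧ Fmax - Fmin = a ^ 2 :=
    ⟨_, Real.sqrt_pos.2 hΔ, (Real.sq_sqrt hΔ0).symm⟩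
  obtain ⟨b, hb, hb2⟩ : ∃ b : ℝ, 0 < b ∧ (β : ℝ) = b ^ 2 :=
    ⟨_, Real.sqrt_pos.2 hβ', (Real.sq_sqrt hβ'.le).symm⟩
  obtain ⟨r, hr, hr2⟩ : ∃ r : ℝ, 0 < r ∧ (K : ℝ) = r ^ 2 :=
    ⟨_, Real.sqrt_pos.2 hKpos, (Real.sq_sqrt hKpos.le).symm⟩
  set S : ℕ → Ω → TERM.Param d := fun k ω =>
    TERM.iterate f x t TERM.averagingWeight (TERM.stepSize t L β B Fmin Fmax K)
      (fun j => {ζ j ω}) (fun j => {ξ j ω}) θ₁ k with hS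
  set T := ∑ k ∈ Finset.Icc m K, ∫ ω, ‖gradient (TERM.tiltedLoss f x t) (S k ω)‖ ^ 2 ∂μ with hT
  have h8 : Real.sqrt 8 = 2 * Real.sqrt 2 := by
    rw [show (8 : ℝ) = 2 ^ 2 * 2 by norm_num, Real.sqrt_mul (by norm_num),
      Real.sqrt_sq (by norm_num)]
  have hsqrt : Real.sqrt (β * (Fmax - Fmin) / K) = b * a / r := by
    rw [hb2, ha2, hr2, ← mul_pow, ← div_pow, Real.sqrt_sq (by positivity)]
  have hgoal : (1 / (K : ℝ)) * T = T / r ^ 2 := by rw [hr2]; ring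
  rw [hgoal, h8, hsqrt, ha2]
  have htriv : ∀ C, (∀ θ, ‖gradient (TERM.tiltedLoss f x t) θ‖ ^ 2 ≤ C) → T / r ^ 2 ≤ C := by
    intro C hC
    have hCnn : 0 ≤ C := (sq_nonneg _).trans (hC θ₁)
    rw [div_le_iff₀ (by positivity), ← hr2]
    calc T ≤ ∑ _k ∈ Finset.Icc m K, C := by
          refine Finset.sum_le_sum fun k _ => ?_
          calc _ ≤ ∫ _ω, C ∂μ := integral_mono_of_nonneg
                (Filter.Eventually.of_forall fun ω => sq_nonneg _) (integrable_const _)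
                (Filter.Eventually.of_forall fun ω => hC _)
            _ = C := by simp
      _ = (Finset.Icc m K).card * C := by simp
      _ ≤ K * C := by gcongr
      _ = C * K := mul_comm _ _
  have hc : 0 < Real.sqrt 2 := Real.sqrt_pos.2 (by norm_num)
  -- Short horizon: the geometric mean of the two pointwise bounds on `‖g‖²`, namely `B√(2βΔ)`, is
  -- already below the claim. In the next split `B²` plays this role; its complement makes `αβ exp
  -- (tΔ) ≤ 1`.
  rcases lt_or_ge r (2 * Real.exp (t * a ^ 2 + 1)) with hrE | hrE
  · have h1 : ∀ θ, ‖gradient (TERM.tiltedLoss f x t) θ‖ ^ 2 ≤ B * (Real.sqrt 2 * (b * a)) := by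
      intro θ
      rw [sq]
      refine mul_le_mul (hgB θ) ?_ (norm_nonneg _) hB.le
      refine (sq_le_sq₀ (norm_nonneg _) (by positivity)).1 ?_
      rw [mul_pow, Real.sq_sqrt (by norm_num), mul_pow, ← hb2, ← ha2]
      linarith [hgβ θ]
    refine (htriv _ h1).trans ?_
    have h2 : 1 ≤ 2 * Real.exp (t * a ^ 2 + 1) / r := (one_le_div hr).2 hrE.le
    calc B * (Real.sqrt 2 * (b * a))
        ≤ B * (Real.sqrt 2 * (b * a)) * (2 * Real.exp (t * a ^ 2 + 1) / r) :=
          le_mul_of_one_le_right (by positivity) h2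
      _ = _ := by ring
  rcases lt_or_ge (B * r) (2 * Real.sqrt 2 * Real.exp (t * a ^ 2 + 1) * (b * a)) with hrB | hrB
  · refine (htriv (B ^ 2) fun θ => pow_le_pow_left₀ (norm_nonneg _) (hgB θ) 2).trans ?_
    calc B ^ 2 = B * (B * r) / r := by field_simp
      _ ≤ B * (2 * Real.sqrt 2 * Real.exp (t * a ^ 2 + 1) * (b * a)) / r := by gcongr
      _ = _ := by ring
  set α := Real.sqrt 2 * a / (Real.exp (t * a ^ 2) * (b * B * r)) with hα
  have hαpos : 0 < α := by rw [hα]; positivity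
  -- `θ_k` is the state after `k - 1` iterations, so the window `m, …, K` becomes `m - 1, …, K - 1`.
  -- As `m ≥ 1` here, it has at most `K` terms.
  have hstepSize : ∀ k, m - 1 ≤ k → TERM.stepSize t L β B Fmin Fmax K (k + 1) = α := by
    intro k hk
    have h1 : Real.sqrt (2 * a ^ 2) = Real.sqrt 2 * a := by
      rw [Real.sqrt_mul (by norm_num), Real.sqrt_sq ha.le]
    have h2 : Real.sqrt (b ^ 2 * B ^ 2 * r ^ 2) = b * B * r := by
      rw [← mul_pow, ← mul_pow, Real.sqrt_sq (by positivity)]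
    rw [TERM.stepSize, if_neg (by omega), ha2, hb2, hr2, h1, h2]
  have hquarter := TERM.step_le_quarter ha hb hr hB hα hrE
  have hsum := TERM.sum_integral_norm_gradient_sq_le (μ := μ) (Z := Sum.elim ζ ξ) ht hB hβ hbdd
    hdiff hsmooth hgrad (by rintro (i | i); exacts [hζ i, hξ i]) hindep
    (by rintro (k | k); exacts [hζ_unif k, hξ_unif k]) θ₁ hαpos
    (show m - 1 ≤ K by omega) hstepSize (by rw [ha2, hb2]; exact hquarter)
  have hTeq : ∑ k ∈ Finset.Ico (m - 1) K, ∫ ω, ‖gradient (TERM.tiltedLoss f x t)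
      (TERM.sampledState f x t TERM.averagingWeight (TERM.stepSize t L β B Fmin Fmax K) θ₁ k
        fun i => Sum.elim ζ ξ i ω).1‖ ^ 2 ∂μ = T := by
    refine Finset.sum_bij (fun k _ => k + 1) ?_ ?_ ?_ ?_
    · intro k hk
      simp only [Finset.mem_Ico, Finset.mem_Icc] at hk ⊢
      omega
    · intro k _ l _ h
      exact Nat.succ_injective h
    · intro k hk
      simp only [Finset.mem_Icc] at hk
      exact ⟨k - 1, by simp only [Finset.mem_Ico]; omega, by omega⟩
    · intro k _
      rfl
  rw [hTeq, ha2, hb2] at hsum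
  refine TERM.sum_le_of_balanced_step ha hb hr hB ht ?_ hα hrB hsum
  rw [← hr2]
  exact_mod_cast by omega
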